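/- Let $d\ge 1$ be an integer. For $n\ge 1$ let $\mathbb T^d_n=(\mathbb R/n^{1/d}\mathbb Z)^d$ be the flat torus of volume $n$, with the metric inherited from the Euclidean metric of $\mathbb R^d$. Embed vertices $0,1,\dots,n-1$ independently and uniformly at random in $\mathbb T^d_n$, and join every vertex $i>0$ by an edge to its parent, a vertex with label in $\{0,\dots,i-1\}$ closest to $i$ in $\mathbb T^d_n$ (ties, which have probability $0$, are broken arbitrarily). Let $G_n$ be the resulting tree on $\{0,\dots,n-1\}$, rooted at $0$. Let $m=m(n)$ be a sequence of non-negative integers with $m=n^{\Omega(1)}$, that is, there is a constant $c>0$ such that $m(n)\ge n^c$ for all sufficiently large $n$. Then the following holds for all sufficiently large $n$ (depending only on $d$ and on the sequence $m$). For every vertex $\ell$ with $m<\ell\le n-1$ there is exactly one vertex $m'=m'(\ell)\in\{0,\dots,m\}$ with $d_{G_n}(\ell,m')=\min_{0\le j\le m} d_{G_n}(\ell,j)$, where $d_{G_n}$ is the graph distance, and $m'$ is an ancestor of $\ell$. Moreover, with probability at least $1-3/m$, simultaneously for all $\ell$ with $m<\ell\le n-1$, the distance in $\mathbb T^d_n$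 between the positions of $\ell$ and $m'(\ell)$ is at most $$\frac{6\sqrt d}{1-2^{-1/d}}\left(\frac{(\log m)^{d+1}\,n}{m}\right)^{1/d}.$$ -/

import Mathlib

open MeasureTheory ProbabilityTheory Filter

noncomputable section

/-- Side length `n ^ (1 / d)` of the flat `d`-dimensional torus of volume `n`. -/
def torusSide (d n : ℕ) : ℝ := (n : ℝ) ^ (1 / (d : ℝ))

instance torusSide_pos (d n : ℕ) [NeZero n] : Fact (0 < torusSide d n) :=
  ⟨Real.rpow_pos_of_pos (Nat.cast_pos.mpr (Nat.pos_of_ne_zero (NeZero.ne n))) _⟩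

/-- The flat torus `(ℝ / n ^ (1 / d) ℤ) ^ d`, of volume `n`. Its measure `volume` is the product
of the Lebesgue measures on the circles, each of which has total mass `n ^ (1 / d)`. -/
abbrev FlatTorus (d n : ℕ) : Type := Fin d → AddCircle (torusSide d n)

/-- The metric on the flat torus inherited from the Euclidean metric of `ℝ ^ d` (the distance of
a product type in Mathlib is the sup distance, so it is not used here). -/
def torusDist {d n : ℕ} (x y : FlatTorus d n) : ℝ :=
  Real.sqrt (∑ k, dist (x k) (y k) ^ 2)

/-- `a` is a choice of parents for vertices `0, …, n - 1` embedded at positions `p`: every label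
`i > 0` is sent to a label `a i < i` whose position is closest to that of `i` among all smaller
labels (a tie may be broken in any way); by convention the root `0` is its own parent. -/
def IsParentChoice {d n : ℕ} (p : Fin n → FlatTorus d n) (a : Fin n → Fin n) : Prop :=
  ∀ i : Fin n, ((i : ℕ) = 0 → a i = i) ∧
    (0 < (i : ℕ) → a i < i ∧ ∀ j : Fin n, j < i → torusDist (p i) (p (a i)) ≤ torusDist (p i) (p j))

/-- The graph on `0, …, n - 1` in which every label `i > 0` is joined by an edge to its parent. -/
def parentGraph {n : ℕ} (a : Fin n → Fin n) : SimpleGraph (Fin n) :=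
  SimpleGraph.fromRel fun i j => 0 < (i : ℕ) ∧ j = a i

/-- The online nearest neighbour process on the torus of volume `n`: `V i` is the random position
of the vertex with label `i`, and `A ω i` is the random label of its parent. The `d`-NN tree is
then the random graph `parentGraph (A ω)`. -/
structure IsOnlineNNProcess {d n : ℕ} [NeZero n] {Ω : Type*} [MeasurableSpace Ω] (P : Measure Ω)
    (V : Fin n → Ω → FlatTorus d n) (A : Ω → Fin n → Fin n) : Prop where
  measurable_position : ∀ i, Measurable (V i)
  uniform_position : ∀ i, pdf.IsUniform (V i) Set.univ P volume
  independent_positions : iIndepFun V P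
  measurable_parent : Measurable A
  isParentChoice : ∀ ω, IsParentChoice (fun i => V i ω) (A ω)

/-- `k` is a vertex of `S` with `d_G(l, k) = d_G(l, S)`, where `d_G(l, S) = inf_{j ∈ S} d_G(l, j)`. -/
def IsGraphNearest {W : Type*} (G : SimpleGraph W) (S : Set W) (l k : W) : Prop :=
  k ∈ S ∧ G.edist l k = ⨅ j ∈ S, G.edist l j

/-- The set `{0, 1, …, m}` of labels, among the labels `0, …, n - 1`. -/
def labelsUpTo (n m : ℕ) : Set (Fin n) := {i | (i : ℕ) ≤ m}

/-- The bound `6 √d / (1 - 2 ^ (-1/d)) * ((log m) ^ (d + 1) * n / m) ^ (1 / d)`. -/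
def ancestorDistBound (d n m : ℕ) : ℝ :=
  6 * Real.sqrt d / (1 - (2 : ℝ) ^ (-(1 / (d : ℝ)))) *
    ((Real.log m) ^ (d + 1) * n / m) ^ (1 / (d : ℝ))

end

/-! Along an edge the number of parent steps needed to reach a label at most `m` changes by at most
one, and only a step to the parent lowers it. Hence the first ancestor of `ℓ` in `{0, …, m}` is its
unique nearest vertex there (`isGraphNearest_iff`). Its distance from `ℓ` on the torus is bounded by
the edge lengths on the ancestral path, grouped by dyadic windows `[2^k m, 2^(k+1) m)` of labels
(`torusDist_hitLabel_le`).

Lengths: with high probability the labels below `2^k m` meet every ball around a grid of about `2^k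
m / (4 log n)` points, so an edge leaving a label of window `k` has length `O((n log n / (2^k
m))^(1/d))`.

Counts: by exchangeability the ancestors of `ℓ` behave like records: label `i < ℓ` occurs with
probability `1/(i+1)`, independently. Precisely, the product of weights `w` over the proper
ancestors has mean `∏ (i + w i)/(i + 1)` (`sum_perm_chainWeight`,
`factorial_mul_lintegral_chainWeight`). Weight `C` on one window gives mean at most `e^C`, and
Markov's inequality bounds the ancestors in that window by `t ≈ (c/4) log m`.

A union bound over windows and labels costs at most `2/n`, and the sum over windows is geometric
with ratio `2^(-1/d)`. -/

/-- The number of steps of `a` after which a label at most `m` is reached from `i`. -/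
noncomputable def hitTime {n : ℕ} (a : Fin n → Fin n) (m : ℕ) (i : Fin n) : ℕ :=
  sInf {t | ((a^[t] i : Fin n) : ℕ) ≤ m}

/-- The first label at most `m` reached from `i` by iterating `a`. -/
noncomputable def hitLabel {n : ℕ} (a : Fin n → Fin n) (m : ℕ) (i : Fin n) : Fin n :=
  a^[hitTime a m i] i

/-! ### Hitting times of the parent map and graph distance -/

section Descent

variable {n : ℕ} {a : Fin n → Fin n} (ha : ∀ i : Fin n, 0 < (i : ℕ) → a i < i)

include ha in
theorem exists_iterate_le (m : ℕ) (i : Fin n) : ∃ t, ((a^[t] i : Fin n) : ℕ) ≤ m := by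
  induction i using WellFoundedLT.induction with
  | ind i ih =>
    by_cases h : (i : ℕ) ≤ m
    · exact ⟨0, h⟩
    · obtain ⟨t, ht⟩ := ih (a i) (ha i (by omega))
      exact ⟨t + 1, by simpa [Function.iterate_succ_apply] using ht⟩

include ha in
theorem hitLabel_le (m : ℕ) (i : Fin n) : (hitLabel a m i : ℕ) ≤ m :=
  Nat.sInf_mem (s := {t | ((a^[t] i : Fin n) : ℕ) ≤ m}) (exists_iterate_le ha m i)

theorem hitTime_of_le {m : ℕ} {i : Fin n} (h : (i : ℕ) ≤ m) : hitTime a m i = 0 :=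
  Nat.sInf_eq_zero.mpr (Or.inl h)

theorem hitLabel_of_le {m : ℕ} {i : Fin n} (h : (i : ℕ) ≤ m) : hitLabel a m i = i := by
  simp [hitLabel, hitTime_of_le h]

include ha in
theorem hitTime_of_lt {m : ℕ} {i : Fin n} (h : m < (i : ℕ)) :
    hitTime a m i = hitTime a m (a i) + 1 := by
  have h1 := hitLabel_le ha m i
  apply le_antisymm
  · apply Nat.sInf_le
    have := hitLabel_le ha m (a i)
    simpa [hitLabel, Function.iterate_succ_apply] using this
  · rcases hs : hitTime a m i with _ | s
    · simp only [hitLabel, hs, Function.iterate_zero, id] at h1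
      omega
    · have : hitTime a m (a i) ≤ s := by
        apply Nat.sInf_le
        simpa [hitLabel, hs, Function.iterate_succ_apply] using h1
      omega

include ha in
theorem hitLabel_of_lt {m : ℕ} {i : Fin n} (h : m < (i : ℕ)) :
    hitLabel a m i = hitLabel a m (a i) := by
  simp [hitLabel, hitTime_of_lt ha h, Function.iterate_succ_apply]

include ha in
-- Induction on the walk. A step to a child wastes length, so equality forces every step above `m`
-- to go to the parent, and the endpoint is determined.
theorem hitTime_le_walk_length {m : ℕ} {u v : Fin n} (w : (parentGraph a).Walk u v)
    (hv : (v : ℕ) ≤ m) :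
    hitTime a m u ≤ w.length ∧ (w.length = hitTime a m u → v = hitLabel a m u) := by
  induction w with
  | nil => simp [hitTime_of_le hv, hitLabel_of_le hv]
  | @cons u x v hux w ih =>
    obtain ⟨ih1, ih2⟩ := ih hv
    rw [SimpleGraph.Walk.length_cons]
    rw [parentGraph, SimpleGraph.fromRel_adj] at hux
    obtain ⟨-, ⟨-, rfl⟩ | ⟨hx, rfl⟩⟩ := hux
    · by_cases hu : (u : ℕ) ≤ m
      · rw [hitTime_of_le hu]
        exact ⟨by omega, by omega⟩
      · rw [hitTime_of_lt ha (not_le.mp hu), hitLabel_of_lt ha (not_le.mp hu)]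
        exact ⟨by omega, fun h => ih2 (by omega)⟩
    · by_cases hx' : (x : ℕ) ≤ m
      · have : ((a x : Fin n) : ℕ) ≤ m := le_trans (le_of_lt (ha x hx)) hx'
        rw [hitTime_of_le this]
        exact ⟨by omega, by omega⟩
      · rw [hitTime_of_lt ha (not_le.mp hx')] at ih1
        exact ⟨by omega, by omega⟩

include ha in
theorem edist_hitLabel_le (m : ℕ) (i : Fin n) :
    (parentGraph a).edist i (hitLabel a m i) ≤ hitTime a m i := by
  induction i using WellFoundedLT.induction with
  | ind i ih =>
    by_cases h : (i : ℕ) ≤ m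
    · simp [hitLabel_of_le h]
    · have h := not_le.mp h
      have hlt := ha i (by omega)
      have hadj : (parentGraph a).Adj i (a i) := by
        rw [parentGraph, SimpleGraph.fromRel_adj]
        exact ⟨hlt.ne', Or.inl ⟨by omega, rfl⟩⟩
      rw [hitLabel_of_lt ha h, hitTime_of_lt ha h, Nat.cast_add, Nat.cast_one, add_comm]
      refine (SimpleGraph.edist_triangle (v := a i)).trans (add_le_add ?_ (ih _ hlt))
      exact (SimpleGraph.edist_eq_one_iff_adj.mpr hadj).le

include ha in
theorem isGraphNearest_iff (m : ℕ) (l k : Fin n) :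
    IsGraphNearest (parentGraph a) (labelsUpTo n m) l k ↔ k = hitLabel a m l := by
  have low : ∀ j ∈ labelsUpTo n m, (hitTime a m l : ℕ∞) ≤ (parentGraph a).edist l j := by
    intro j hj
    refine le_iInf fun w => ?_
    exact_mod_cast (hitTime_le_walk_length ha w hj).1
  have hmem : hitLabel a m l ∈ labelsUpTo n m := hitLabel_le ha m l
  have heq : ⨅ j ∈ labelsUpTo n m, (parentGraph a).edist l j = hitTime a m l :=
    le_antisymm ((iInf₂_le _ hmem).trans (edist_hitLabel_le ha m l)) (le_iInf₂ low)
  rw [IsGraphNearest, heq]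
  constructor
  · rintro ⟨hk, hd⟩
    have hr : (parentGraph a).Reachable l k := by
      rw [← SimpleGraph.edist_ne_top_iff_reachable, hd]
      exact ENat.natCast_ne_top _
    obtain ⟨w, hw⟩ := hr.exists_walk_length_eq_edist
    refine (hitTime_le_walk_length ha w hk).2 ?_
    rw [hd] at hw
    exact_mod_cast hw
  · rintro rfl
    exact ⟨hmem, le_antisymm (edist_hitLabel_le ha m l) (low _ hmem)⟩

/-- The label `i` together with its ancestors. -/
def ancestors (a : Fin n → Fin n) (i : Fin n) : Set (Fin n) := {j | ∃ t, a^[t] i = j}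

theorem ancestors_eq_insert (a : Fin n → Fin n) (i : Fin n) :
    ancestors a i = insert i (ancestors a (a i)) := by
  ext j
  constructor
  · rintro ⟨_ | t, ht⟩
    · exact Or.inl ht.symm
    · exact Or.inr ⟨t, ht⟩
  · rintro (rfl | ⟨t, ht⟩)
    · exact ⟨0, rfl⟩
    · exact ⟨t + 1, ht⟩

include ha in
theorem le_of_mem_ancestors (ha0 : ∀ i : Fin n, (i : ℕ) = 0 → a i = i) {i j : Fin n}
    (h : j ∈ ancestors a i) : j ≤ i := by
  obtain ⟨t, rfl⟩ := h
  induction t with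
  | zero => exact le_rfl
  | succ t ih =>
    rw [Function.iterate_succ_apply']
    rcases Nat.eq_zero_or_pos (a^[t] i : Fin n) with h | h
    · rwa [ha0 _ h]
    · exact (ha _ h).le.trans ih

end Descent

/-! ### Grids, ball volumes and absence of ties on the torus -/

section TorusGeometry

variable {d n : ℕ}

theorem torusDist_eq_dist_toLp (x y : FlatTorus d n) :
    torusDist x y = dist (WithLp.toLp 2 x) (WithLp.toLp 2 y) := by
  rw [PiLp.dist_eq_of_L2]
  rfl

theorem torusDist_self (x : FlatTorus d n) : torusDist x x = 0 := by
  rw [torusDist_eq_dist_toLp, dist_self]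

theorem torusDist_triangle (x y z : FlatTorus d n) :
    torusDist x z ≤ torusDist x y + torusDist y z := by
  simp only [torusDist_eq_dist_toLp]
  exact dist_triangle _ _ _

theorem torusDist_le_of_dist_le {x y : FlatTorus d n} {r : ℝ} (h : dist x y ≤ r) :
    torusDist x y ≤ Real.sqrt d * r := by
  have hr : 0 ≤ r := dist_nonneg.trans h
  have : ∑ k, dist (x k) (y k) ^ 2 ≤ d * r ^ 2 := by
    calc ∑ k, dist (x k) (y k) ^ 2 ≤ ∑ _k : Fin d, r ^ 2 := by
          gcongr with k
          exact (dist_le_pi_dist x y k).trans h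
      _ = d * r ^ 2 := by simp
  calc torusDist x y ≤ Real.sqrt (d * r ^ 2) := Real.sqrt_le_sqrt this
    _ = Real.sqrt d * r := by rw [Real.sqrt_mul (Nat.cast_nonneg d), Real.sqrt_sq hr]

theorem measurable_torusDist [NeZero n] {α : Type*} [MeasurableSpace α] {f g : α → FlatTorus d n}
    (hf : Measurable f) (hg : Measurable g) : Measurable fun x => torusDist (f x) (g x) :=
  Measurable.sqrt <| Finset.measurable_fun_sum _ fun k _ =>
    (Measurable.dist ((measurable_pi_apply k).comp hf) ((measurable_pi_apply k).comp hg)).pow_const 2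

variable [NeZero n]

/-- A sphere in a circle has at most two points, `u + s` and `u - s`. -/
theorem addCircle_volume_dist_eq {L : ℝ} [Fact (0 < L)] (u : AddCircle L) (s : ℝ) :
    volume {x : AddCircle L | dist u x = s} = 0 := by
  have hL : 0 < L := Fact.out
  have hsub : {x : AddCircle L | dist u x = s} ⊆ {u + (s : AddCircle L), u - (s : AddCircle L)} := by
    intro x hx
    obtain ⟨y, hy⟩ := QuotientAddGroup.mk_surjective (x - u)
    have hx' : ‖x - u‖ = s := by rw [← dist_eq_norm, dist_comm]; exact hx
    -- The representative of `x - u` of least modulus, whose absolute value is the norm.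
    set z : ℝ := y - round (L⁻¹ * y) * L with hz
    have hzy : (z : AddCircle L) = x - u := by
      rw [← hy, hz, ← zsmul_eq_mul, AddCircle.coe_sub, AddCircle.coe_zsmul, AddCircle.coe_period]
      simp
    have hzs : |z| = s := by
      rw [← hx', ← hy]
      exact (AddCircle.norm_eq L).symm
    rcases abs_cases z with ⟨h, -⟩ | ⟨h, -⟩
    · left
      rw [← hzs, h, hzy]
      abel
    · right
      rw [Set.mem_singleton_iff, ← hzs, h, AddCircle.coe_neg, hzy]
      abel
  have hpt : ∀ x : AddCircle L, volume {x} = 0 := by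
    intro x
    have := AddCircle.volume_closedBall L (x := x) 0
    rw [Metric.closedBall_zero] at this
    rw [this]
    simp [hL.le]
  refine measure_mono_null hsub ?_
  rw [Set.insert_eq]
  exact measure_union_null (hpt _) (hpt _)

theorem addCircle_exists_dist_le {L : ℝ} [Fact (0 < L)] {q : ℕ} (hq : 0 < q) (x : AddCircle L) :
    ∃ j : Fin q, dist x (((j : ℕ) * (L / q) : ℝ) : AddCircle L) ≤ L / q := by
  have hL : 0 < L := Fact.out
  have hq' : (0 : ℝ) < q := Nat.cast_pos.mpr hq
  have hs : 0 < L / q := div_pos hL hq'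
  obtain ⟨y, hy⟩ : ∃ y : Set.Ico 0 (0 + L), (y : AddCircle L) = x :=
    ⟨AddCircle.equivIco L 0 x, AddCircle.coe_equivIco⟩
  obtain ⟨y, hy0, hy1⟩ := y
  rw [zero_add] at hy1
  have hf : ⌊y / (L / q)⌋₊ < q := by
    rw [Nat.floor_lt (div_nonneg hy0 hs.le), div_lt_iff₀ hs]
    field_simp
    exact hy1
  refine ⟨⟨_, hf⟩, ?_⟩
  have h1 := Nat.floor_le (div_nonneg hy0 hs.le)
  have h2 := Nat.lt_floor_add_one (y / (L / q))
  rw [le_div_iff₀ hs] at h1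
  rw [div_lt_iff₀ hs] at h2
  rw [← hy, dist_eq_norm, ← AddCircle.coe_sub]
  refine (QuotientAddGroup.norm_mk_le_norm).trans ?_
  rw [Real.norm_eq_abs]
  rw [abs_le]
  constructor <;> dsimp only <;> linarith

/-- The points of a square grid with `q` points per axis in the flat torus. -/
noncomputable def torusGrid (d n : ℕ) (q : ℕ) (j : Fin d → Fin q) : FlatTorus d n :=
  fun k => (((j k : ℕ) * (torusSide d n / q) : ℝ) : AddCircle (torusSide d n))

theorem exists_dist_torusGrid_le {q : ℕ} (hq : 0 < q) (x : FlatTorus d n) :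
    ∃ j, dist x (torusGrid d n q j) ≤ torusSide d n / q := by
  choose j hj using fun k => addCircle_exists_dist_le hq (x k)
  refine ⟨j, (dist_pi_le_iff ?_).mpr hj⟩
  exact div_nonneg (torusSide_pos d n).out.le (Nat.cast_nonneg q)

/-- The uniform distribution on the flat torus. -/
noncomputable abbrev torusUniform (d n : ℕ) [NeZero n] : Measure (FlatTorus d n) :=
  ProbabilityTheory.cond volume Set.univ

theorem volume_flatTorus_univ :
    volume (Set.univ : Set (FlatTorus d n)) = ENNReal.ofReal (torusSide d n) ^ d := by
  rw [volume_pi, Measure.pi_univ]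
  simp [AddCircle.measure_univ]

instance isProbabilityMeasure_torusUniform : IsProbabilityMeasure (torusUniform d n) := by
  refine ProbabilityTheory.cond_isProbabilityMeasure_of_finite ?_ ?_ <;>
  rw [volume_flatTorus_univ]
  · exact pow_ne_zero _ (by simpa using (torusSide_pos d n).out)
  · exact ENNReal.pow_ne_top ENNReal.ofReal_ne_top

/-- A ball for the sup distance is a product of arcs of length `min L (2 L / q) ≥ L / q`, where `L`
is the side. -/
theorem inv_pow_le_torusUniform_closedBall {q : ℕ} (hq : 0 < q) (c : FlatTorus d n) :
    ((q : ℝ) ^ d)⁻¹ ≤ (torusUniform d n).real (Metric.closedBall c (torusSide d n / q)) := by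
  have hL := (torusSide_pos d n).out
  have hq' : (1 : ℝ) ≤ q := Nat.one_le_cast.mpr hq
  have hs : 0 < torusSide d n / q := div_pos hL (by linarith)
  have hball : ENNReal.ofReal (torusSide d n / q) ^ d ≤
      volume (Metric.closedBall c (torusSide d n / q)) := by
    rw [closedBall_pi _ hs.le, volume_pi, Measure.pi_pi]
    calc ENNReal.ofReal (torusSide d n / q) ^ d
        = ∏ _k : Fin d, ENNReal.ofReal (torusSide d n / q) := by simp
      _ ≤ _ := by
        refine Finset.prod_le_prod' fun k _ => ?_
        rw [AddCircle.volume_closedBall]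
        refine ENNReal.ofReal_le_ofReal (le_min ?_ ?_)
        · exact div_le_self hL.le hq'
        · linarith
  rw [measureReal_def, ProbabilityTheory.cond_apply MeasurableSet.univ, Set.univ_inter,
    volume_flatTorus_univ, ENNReal.toReal_mul]
  have h2 : (torusSide d n / q) ^ d ≤
      (volume (Metric.closedBall c (torusSide d n / q))).toReal := by
    have := ENNReal.toReal_mono (measure_ne_top _ _) hball
    rwa [ENNReal.toReal_pow, ENNReal.toReal_ofReal hs.le] at this
  rw [ENNReal.toReal_inv, ENNReal.toReal_pow, ENNReal.toReal_ofReal hL.le]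
  rw [div_pow] at h2
  calc ((q : ℝ) ^ d)⁻¹ = (torusSide d n ^ d)⁻¹ * (torusSide d n ^ d / q ^ d) := by
        have : torusSide d n ^ d ≠ 0 := (pow_pos hL d).ne'
        field_simp
    _ ≤ _ := by gcongr

/-- Fubini with coordinate `j` integrated first. -/
theorem pi_null_of_slices {N : ℕ} {α : Type*} [MeasurableSpace α] (ν : Measure α) [SigmaFinite ν]
    (j : Fin (N + 1)) {E : Set (Fin (N + 1) → α)} (hE : MeasurableSet E)
    (h : ∀ y : Fin N → α, ν {x | j.insertNth (α := fun _ => α) x y ∈ E} = 0) :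
    Measure.pi (fun _ => ν) E = 0 := by
  have hmp := (measurePreserving_piFinSuccAbove (fun _ : Fin (N + 1) => ν) j).symm
  rw [← hmp.measure_preimage hE.nullMeasurableSet,
    Measure.prod_apply_symm (hmp.measurable hE), lintegral_eq_zero_iff']
  · exact Eventually.of_forall h
  · exact (measurable_measure_prodMk_right (hmp.measurable hE)).aemeasurable

/-- Once the other coordinates are fixed, the first coordinate lies on a sphere of a circle, a null
set. -/
theorem volume_torusDist_eq (hd : d ≠ 0) (u : FlatTorus d n) (s : ℝ) :
    volume {x : FlatTorus d n | torusDist u x = s} = 0 := by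
  have key : ∀ (D : ℕ) (u : Fin (D + 1) → AddCircle (torusSide d n)) (r : ℝ),
      volume {x : Fin (D + 1) → AddCircle (torusSide d n) | ∑ k, dist (u k) (x k) ^ 2 = r} = 0 := by
    intro D u r
    rw [volume_pi]
    refine pi_null_of_slices _ 0 (measurableSet_eq_fun (by fun_prop) (by fun_prop)) fun y => ?_
    refine measure_mono_null ?_
      (addCircle_volume_dist_eq (u 0) (Real.sqrt (r - ∑ k, dist (u (Fin.succ k)) (y k) ^ 2)))
    intro x hx
    simp only [Fin.insertNth_zero', Set.mem_ofPred_eq, Fin.sum_univ_succ, Fin.cons_zero,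
      Fin.cons_succ] at hx
    rw [Set.mem_ofPred_eq, ← hx, add_sub_cancel_right, Real.sqrt_sq dist_nonneg]
  obtain ⟨D, rfl⟩ := Nat.exists_eq_succ_of_ne_zero hd
  refine measure_mono_null ?_ (key D u (s ^ 2))
  intro x hx
  rw [Set.mem_ofPred_eq] at hx ⊢
  rw [← hx, torusDist, Real.sq_sqrt (Finset.sum_nonneg fun k _ => sq_nonneg _)]

/-- No point of the family `p` has the same distance to two other ones. -/
def TieFree {N : ℕ} (p : Fin N → FlatTorus d n) : Prop :=
  ∀ i j k, i ≠ j → i ≠ k → j ≠ k → torusDist (p i) (p j) ≠ torusDist (p i) (p k)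

theorem ae_tieFree (hd : d ≠ 0) (N : ℕ) :
    ∀ᵐ p ∂Measure.pi (fun _ : Fin N => torusUniform d n), TieFree p := by
  simp only [TieFree, ae_all_iff]
  intro i j k hij hik hjk
  rcases N with _ | N
  · exact i.elim0
  obtain ⟨i, rfl⟩ := Fin.exists_succAbove_eq hij
  obtain ⟨k, rfl⟩ := Fin.exists_succAbove_eq hjk.symm
  refine pi_null_of_slices _ j ?_ fun y => ?_
  · exact (measurableSet_eq_fun (measurable_torusDist (by fun_prop) (by fun_prop))
      (measurable_torusDist (by fun_prop) (by fun_prop))).compl.compl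
  · refine ProbabilityTheory.cond_absolutelyContinuous
      (measure_mono_null ?_ (volume_torusDist_eq hd (y i) (torusDist (y i) (y k))))
    intro x hx
    simpa using hx

end TorusGeometry

/-! ### Nearest neighbour chains averaged over relabellings -/

/-- The product of the weights of the labels on the nearest neighbour chain started from the query
point `q`, among the points `x 0, x 1, …, x (j - 1)` with labels `j - 1, j - 2, …, 0`. -/
noncomputable def chainWeight {T : Type*} (δ : T → T → ℝ) (w : ℕ → ℕ) :
    (j : ℕ) → T → (Fin j → T) → ℕ
  | 0, _, _ => 1
  | j + 1, q, x =>
    open Classical in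
    if ∀ i, δ q (x 0) ≤ δ q (x i) then w j * chainWeight δ w j (x 0) (fun i => x i.succ)
    else chainWeight δ w j q (fun i => x i.succ)

section ChainWeight

variable {T : Type*} (δ : T → T → ℝ) (w : ℕ → ℕ)

/-- Split the permutations by the point `b` carrying the newest label. Exactly one `b` is nearest to
`q` and yields the factor `w j`; the `j` others yield `1`. In either case the remaining points are
in uniform order, so the induction hypothesis gives the same product `D`, whichever query point
continues the chain. -/
theorem sum_perm_chainWeight (j : ℕ) : ∀ (q : T) (x : Fin j → T),
    (∀ i k, i ≠ k → δ q (x i) ≠ δ q (x k)) →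
    (∀ h i k, h ≠ i → h ≠ k → i ≠ k → δ (x h) (x i) ≠ δ (x h) (x k)) →
    ∑ σ : Equiv.Perm (Fin j), chainWeight δ w j q (x ∘ σ) = ∏ i ∈ Finset.range j, (i + w i) := by
  classical
  induction j with
  | zero => intro q x _ _; simp [chainWeight]
  | succ j ih =>
    intro q x hq hx
    set D := ∏ i ∈ Finset.range j, (i + w i) with hD
    have inner : ∀ b : Fin (j + 1),
        ∑ e : Equiv.Perm (Fin j),
          chainWeight δ w (j + 1) q (x ∘ Equiv.Perm.decomposeFin.symm (b, e)) =
        if ∀ i, δ q (x b) ≤ δ q (x i) then w j * D else D := by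
      intro b
      have hinj : ∀ i k : Fin j, i ≠ k →
          Equiv.swap 0 b i.succ ≠ Equiv.swap 0 b k.succ := by
        intro i k hik h
        exact hik (Fin.succ_injective _ ((Equiv.swap 0 b).injective h))
      have hne : ∀ i : Fin j, b ≠ Equiv.swap 0 b i.succ := by
        intro i h
        have h2 := (Equiv.swap_apply_left 0 b).trans h
        exact Fin.succ_ne_zero _ ((Equiv.swap 0 b).injective h2).symm
      have hcond : ∀ e : Equiv.Perm (Fin j),
          (∀ i, δ q ((x ∘ Equiv.Perm.decomposeFin.symm (b, e)) 0) ≤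
            δ q ((x ∘ Equiv.Perm.decomposeFin.symm (b, e)) i)) ↔ ∀ i, δ q (x b) ≤ δ q (x i) := by
        intro e
        simp only [Function.comp_apply, Equiv.Perm.decomposeFin_symm_apply_zero]
        exact (Equiv.Perm.decomposeFin.symm (b, e)).surjective.forall
          (p := fun i => δ q (x b) ≤ δ q (x i)) |>.symm
      have htail : ∀ e : Equiv.Perm (Fin j),
          (fun i : Fin j => (x ∘ Equiv.Perm.decomposeFin.symm (b, e)) i.succ) =
            (fun i : Fin j => x (Equiv.swap 0 b i.succ)) ∘ e := by
        intro e
        funext i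
        simp [Equiv.Perm.decomposeFin_symm_apply_succ]
      have hx' : ∀ h i k : Fin j, h ≠ i → h ≠ k → i ≠ k →
          δ (x (Equiv.swap 0 b h.succ)) (x (Equiv.swap 0 b i.succ)) ≠
            δ (x (Equiv.swap 0 b h.succ)) (x (Equiv.swap 0 b k.succ)) :=
        fun h i k h1 h2 h3 => hx _ _ _ (hinj _ _ h1) (hinj _ _ h2) (hinj _ _ h3)
      simp only [chainWeight, hcond, htail]
      split_ifs
      · rw [← Finset.mul_sum]
        congr 1
        simp only [Function.comp_apply, Equiv.Perm.decomposeFin_symm_apply_zero]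
        exact ih (x b) _ (fun i k hik => hx _ _ _ (hne i) (hne k) (hinj _ _ hik)) hx'
      · exact ih q _ (fun i k hik => hq _ _ (hinj _ _ hik)) hx'
    rw [← Equiv.sum_comp Equiv.Perm.decomposeFin.symm, Fintype.sum_prod_type,
      Finset.sum_congr rfl fun b _ => inner b]
    obtain ⟨b, -, hb⟩ := Finset.exists_min_image Finset.univ (fun i => δ q (x i)) ⟨0, Finset.mem_univ _⟩
    have huniq : ∀ c, (∀ i, δ q (x c) ≤ δ q (x i)) ↔ c = b := by
      intro c
      constructor
      · intro hc
        by_contra hcb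
        exact hq c b hcb (le_antisymm (hc b) (hb c (Finset.mem_univ _)))
      · rintro rfl i
        exact hb i (Finset.mem_univ _)
    simp only [huniq]
    rw [Finset.prod_range_succ, ← hD, ← Finset.add_sum_erase _ _ (Finset.mem_univ b), if_pos rfl,
      Finset.sum_congr rfl fun c hc => if_neg (Finset.ne_of_mem_erase hc)]
    simp
    ring

/-- The labels `j - 1, j - 2, …, 0`, as labels among `0, …, n - 1`. -/
def revLabels {n j : ℕ} (h : j ≤ n) : Fin j ↪ Fin n where
  toFun i := ⟨j - 1 - i, by omega⟩
  inj' i k hik := by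
    simp only [Fin.mk.injEq] at hik
    ext
    omega

theorem revLabels_val {n j : ℕ} (h : j ≤ n) (i : Fin j) : (revLabels h i : ℕ) = j - 1 - i := rfl

/-- Labels above `κ` are discarded one by one since `κ` beats them; at `κ` the chain restarts from
`p κ`. -/
theorem chainWeight_eq_of_nearest {n : ℕ} (p : Fin n → T) (q : T) (κ : Fin n) {j : ℕ} (hj : j ≤ n)
    (hκ : (κ : ℕ) < j)
    (hmin : ∀ i : Fin n, (i : ℕ) < j → i ≠ κ → δ q (p κ) < δ q (p i)) :
    chainWeight δ w j q (p ∘ revLabels hj) =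
      w κ * chainWeight δ w κ (p κ) (p ∘ revLabels κ.isLt.le) := by
  induction j with
  | zero => omega
  | succ j ih =>
    have htail : (fun i : Fin j => (p ∘ revLabels hj) i.succ) =
        p ∘ revLabels (Nat.le_of_succ_le hj) := by
      funext i
      refine congrArg p (Fin.ext ?_)
      rw [revLabels_val, revLabels_val, Fin.val_succ]
      omega
    have hzero : (p ∘ revLabels hj) 0 = p ⟨j, hj⟩ := rfl
    rw [chainWeight, htail, hzero]
    by_cases h : (κ : ℕ) = j
    · subst h
      rw [if_pos]
      intro i
      by_cases hi : revLabels hj i = κ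
      · simp [hi]
      · refine (hmin _ ?_ hi).le
        rw [revLabels_val]
        omega
    · rw [if_neg, ih _ (by omega) fun i hi => hmin i (by omega)]
      intro hall
      have h1 := hall ⟨j - κ, by omega⟩
      have h2 : revLabels hj ⟨j - κ, by omega⟩ = κ := by
        ext
        rw [revLabels_val]
        dsimp only
        omega
      rw [Function.comp_apply, h2] at h1
      exact absurd h1 (not_le.mpr (hmin _ (by simp) (by
        intro h3
        apply h
        rw [← h3])))

open Classical in
/-- The ancestors of the label `i` other than `i`. -/
noncomputable def properAncestors {n : ℕ} (a : Fin n → Fin n) (i : Fin n) : Finset (Fin n) :=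
  {j | j ∈ ancestors a i ∧ j ≠ i}

theorem properAncestors_of_pos {n : ℕ} {a : Fin n → Fin n} (ha : ∀ i : Fin n, 0 < (i : ℕ) → a i < i)
    (ha0 : ∀ i : Fin n, (i : ℕ) = 0 → a i = i) {i : Fin n} (hi : 0 < (i : ℕ)) :
    properAncestors a i = insert (a i) (properAncestors a (a i)) := by
  ext j
  simp only [properAncestors, Finset.mem_filter, Finset.mem_univ, true_and, Finset.mem_insert]
  rw [ancestors_eq_insert a i, Set.mem_insert_iff]
  constructor
  · rintro ⟨h | h, hne⟩
    · exact absurd h hne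
    · by_cases hj : j = a i
      · exact Or.inl hj
      · exact Or.inr ⟨h, hj⟩
  · rintro (rfl | ⟨h, -⟩)
    · exact ⟨Or.inr ⟨0, rfl⟩, (ha i hi).ne⟩
    · exact ⟨Or.inr h, ((le_of_mem_ancestors ha ha0 h).trans_lt (ha i hi)).ne⟩

theorem notMem_properAncestors {n : ℕ} (a : Fin n → Fin n) (i : Fin n) :
    i ∉ properAncestors a i := by
  simp [properAncestors]

theorem chainWeight_eq_prod {n : ℕ} (p : Fin n → T) {a : Fin n → Fin n}
    (ha : ∀ i : Fin n, 0 < (i : ℕ) → a i < i) (ha0 : ∀ i : Fin n, (i : ℕ) = 0 → a i = i)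
    (hmin : ∀ i j : Fin n, j < i → j ≠ a i → δ (p i) (p (a i)) < δ (p i) (p j)) (i : Fin n) :
    chainWeight δ w i (p i) (p ∘ revLabels i.isLt.le) = ∏ j ∈ properAncestors a i, w j := by
  induction i using WellFoundedLT.induction with
  | ind i ih =>
    rcases Nat.eq_zero_or_pos (i : ℕ) with h | h
    · have hempty : properAncestors a i = ∅ := by
        rw [Finset.eq_empty_iff_forall_notMem]
        intro j hj
        simp only [properAncestors, Finset.mem_filter, Finset.mem_univ, true_and] at hj
        have := le_of_mem_ancestors ha ha0 hj.1
        apply hj.2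
        ext
        have : (j : ℕ) ≤ i := this
        omega
      rw [hempty, Finset.prod_empty]
      obtain ⟨i, hi⟩ := i
      dsimp only at h
      subst h
      rfl
    · rw [chainWeight_eq_of_nearest δ w p (p i) (a i) i.isLt.le (ha i h) fun j hj hne =>
        hmin i j hj hne, ih _ (ha i h), properAncestors_of_pos ha ha0 h,
        Finset.prod_insert (notMem_properAncestors a (a i))]

end ChainWeight

/-! ### Moment bound for ancestors and covering bound for balls -/

section Probability

variable {d n : ℕ} [NeZero n]

/-- The joint distribution of `N` independent uniform points of the flat torus. -/
noncomputable abbrev torusUniformPi (d n N : ℕ) [NeZero n] : Measure (Fin N → FlatTorus d n) :=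
  Measure.pi fun _ => torusUniform d n

theorem measurable_chainWeight {α : Type*} [MeasurableSpace α] (w : ℕ → ℕ) {j : ℕ}
    {f : α → FlatTorus d n} {g : α → Fin j → FlatTorus d n} (hf : Measurable f)
    (hg : ∀ i, Measurable fun x => g x i) :
    Measurable fun x => (chainWeight torusDist w j (f x) (g x) : ENNReal) := by
  refine (measurable_from_top (f := fun k : ℕ => (k : ENNReal))).comp ?_
  induction j generalizing f with
  | zero => exact measurable_const
  | succ j ih =>
    simp only [chainWeight]
    refine Measurable.ite ?_ (measurable_const.mul (ih (hg 0) fun i => hg i.succ))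
      (ih hf fun i => hg i.succ)
    rw [Set.ofPred_forall]
    exact MeasurableSet.iInter fun i =>
      measurableSet_le (measurable_torusDist hf (hg 0)) (measurable_torusDist hf (hg i))

theorem measurePreserving_comp_perm {N : ℕ} (τ : Equiv.Perm (Fin N)) :
    MeasurePreserving (fun p : Fin N → FlatTorus d n => p ∘ τ) (torusUniformPi d n N)
      (torusUniformPi d n N) := by
  convert! measurePreserving_piCongrLeft (fun _ : Fin N => torusUniform d n) τ.symm using 1
  funext p i
  have := Equiv.piCongrLeft_apply_apply (fun _ : Fin N => FlatTorus d n) τ.symm p (τ i)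
  rw [Equiv.symm_apply_apply] at this
  exact this.symm

/-- Permuting the first `l` points preserves the joint law, so the integral may be averaged over all
`l!` orders; the sum over orders is almost surely a constant. -/
theorem factorial_mul_lintegral_chainWeight (hd : d ≠ 0) {N : ℕ} (w : ℕ → ℕ) (l : Fin N) :
    ((l : ℕ).factorial : ENNReal) * ∫⁻ p : Fin N → FlatTorus d n,
      (chainWeight torusDist w l (p l) (p ∘ revLabels l.isLt.le) : ENNReal) ∂torusUniformPi d n N =
      ((∏ i ∈ Finset.range l, (i + w i) : ℕ) : ENNReal) := by
  set e := revLabels l.isLt.le with he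
  have hmeas : ∀ σ : Equiv.Perm (Fin l), Measurable fun p : Fin N → FlatTorus d n =>
      (chainWeight torusDist w l (p l) (p ∘ e ∘ σ) : ENNReal) := by
    exact fun σ => measurable_chainWeight w (measurable_pi_apply l) fun i => measurable_pi_apply _
  have hinv : ∀ σ : Equiv.Perm (Fin l),
      ∫⁻ p : Fin N → FlatTorus d n,
        (chainWeight torusDist w l (p l) (p ∘ e ∘ σ) : ENNReal) ∂torusUniformPi d n N =
      ∫⁻ p : Fin N → FlatTorus d n,
        (chainWeight torusDist w l (p l) (p ∘ e) : ENNReal) ∂torusUniformPi d n N := by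
    intro σ
    -- `σ` is extended by the identity to all labels, so it fixes the query label `l`.
    rw [← (measurePreserving_comp_perm (σ.viaEmbedding e)).lintegral_comp
      (f := fun p => (chainWeight torusDist w l (p l) (p ∘ e) : ENNReal)) (hmeas 1)]
    refine lintegral_congr fun p => ?_
    have h1 : σ.viaEmbedding e l = l := by
      apply Equiv.Perm.viaEmbedding_apply_of_notMem
      rintro ⟨i, hi⟩
      have := congrArg Fin.val hi
      rw [he, revLabels_val] at this
      omega
    have h2 : (p ∘ σ.viaEmbedding e) ∘ e = p ∘ e ∘ σ := by
      funext i
      simp [Equiv.Perm.viaEmbedding_apply]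
    rw [Function.comp_apply, h1, ← h2]
  calc _ = ∑ σ : Equiv.Perm (Fin l), ∫⁻ p : Fin N → FlatTorus d n,
        (chainWeight torusDist w l (p l) (p ∘ e ∘ σ) : ENNReal) ∂torusUniformPi d n N := by
        rw [Finset.sum_congr rfl fun σ _ => hinv σ]
        simp [Fintype.card_perm]
    _ = ∫⁻ p : Fin N → FlatTorus d n, ∑ σ : Equiv.Perm (Fin l),
        (chainWeight torusDist w l (p l) (p ∘ e ∘ σ) : ENNReal) ∂torusUniformPi d n N :=
        (lintegral_finsetSum _ fun σ _ => hmeas σ).symm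
    _ = ∫⁻ _p : Fin N → FlatTorus d n, ((∏ i ∈ Finset.range l, (i + w i) : ℕ) : ENNReal)
        ∂torusUniformPi d n N := by
        refine lintegral_congr_ae ?_
        filter_upwards [ae_tieFree hd N] with p hp
        have hl : ∀ i, l ≠ e i := by
          intro i hi
          have := congrArg Fin.val hi
          rw [he, revLabels_val] at this
          omega
        have := sum_perm_chainWeight torusDist w l (p l) (p ∘ e)
          (fun i k hik => hp _ _ _ (hl i) (hl k) (e.injective.ne hik))
          (fun h i k h1 h2 h3 => hp _ _ _ (e.injective.ne h1) (e.injective.ne h2)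
            (e.injective.ne h3))
        rw [← this, Nat.cast_sum]
        rfl
    _ = _ := by simp

/-- Weight `c` on the labels in `[M, 2 M)`, and weight `1` on the other ones. -/
def windowWeight (c M : ℕ) (i : ℕ) : ℕ := if M ≤ i ∧ i < 2 * M then c else 1

/-- For `i ≥ M`, `i + c ≤ (i + 1)(1 + c/M) ≤ (i + 1) e^(c/M)`, and at most `M` indices lie in the
window. -/
theorem prod_add_windowWeight_le (c M l : ℕ) :
    ((∏ i ∈ Finset.range l, (i + windowWeight c M i) : ℕ) : ℝ) ≤ l.factorial * Real.exp c := by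
  have hterm : ∀ i : ℕ, ((i + windowWeight c M i : ℕ) : ℝ) ≤
      ((i + 1 : ℕ) : ℝ) * Real.exp (if M ≤ i ∧ i < 2 * M then (c : ℝ) / M else 0) := by
    intro i
    rw [windowWeight]
    split_ifs with h
    · have hM : (0 : ℝ) < M := by
        have : 0 < M := by omega
        exact_mod_cast this
      have hi : (M : ℝ) ≤ i := by exact_mod_cast h.1
      have h1 : (c : ℝ) / M + 1 ≤ Real.exp (c / M) := Real.add_one_le_exp _
      calc ((i + c : ℕ) : ℝ) = i + c := by push_cast; ring
        _ ≤ i + 1 + (i + 1) * (c / M) := by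
          have : (c : ℝ) ≤ (i + 1) * (c / M) := by
            rw [mul_div_assoc', le_div_iff₀ hM, mul_comm]
            gcongr
            linarith
          linarith
        _ = ((i + 1 : ℕ) : ℝ) * (c / M + 1) := by push_cast; ring
        _ ≤ _ := by gcongr
    · simp
  rw [Nat.cast_prod]
  refine (Finset.prod_le_prod (fun i _ => Nat.cast_nonneg _) fun i _ => hterm i).trans ?_
  rw [Finset.prod_mul_distrib, ← Nat.cast_prod, Finset.prod_range_add_one_eq_factorial,
    ← Real.exp_sum]
  gcongr
  rw [← Finset.sum_filter, Finset.sum_const, nsmul_eq_mul]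
  have hcard : (Finset.filter (fun i => M ≤ i ∧ i < 2 * M) (Finset.range l)).card ≤ M := by
    calc _ ≤ (Finset.Ico M (2 * M)).card := Finset.card_le_card fun i hi => by
          simp only [Finset.mem_filter] at hi
          exact Finset.mem_Ico.mpr hi.2
      _ = M := by rw [Nat.card_Ico]; omega
  calc _ ≤ (M : ℝ) * (c / M) := by gcongr
    _ ≤ c := by
      rcases Nat.eq_zero_or_pos M with rfl | hM
      · simp
      · rw [mul_div_cancel₀ _ (Nat.cast_ne_zero.mpr hM.ne')]

theorem measure_pow_le_chainWeight_le (hd : d ≠ 0) {N c : ℕ} (hc : 0 < c) (t M : ℕ) (l : Fin N) :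
    torusUniformPi d n N {p | c ^ t ≤
      chainWeight torusDist (windowWeight c M) l (p l) (p ∘ revLabels l.isLt.le)} ≤
      ENNReal.ofReal (Real.exp c / c ^ t) := by
  have hfac : ((l : ℕ).factorial : ENNReal) ≠ 0 := by exact_mod_cast Nat.factorial_ne_zero _
  have hint : ∫⁻ p : Fin N → FlatTorus d n, (chainWeight torusDist (windowWeight c M) l (p l)
      (p ∘ revLabels l.isLt.le) : ENNReal) ∂torusUniformPi d n N ≤ ENNReal.ofReal (Real.exp c) := by
    rw [← ENNReal.mul_le_mul_iff_right hfac (ENNReal.natCast_ne_top _),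
      factorial_mul_lintegral_chainWeight hd, ← ENNReal.ofReal_natCast, ← ENNReal.ofReal_natCast,
      ← ENNReal.ofReal_mul (Nat.cast_nonneg _)]
    exact ENNReal.ofReal_le_ofReal (prod_add_windowWeight_le c M l)
  have hmeas : Measurable fun p : Fin N → FlatTorus d n => (chainWeight torusDist
      (windowWeight c M) l (p l) (p ∘ revLabels l.isLt.le) : ENNReal) := by
    exact measurable_chainWeight _ (measurable_pi_apply l) fun i => measurable_pi_apply _
  have hct : (0 : ℝ) < (c : ℝ) ^ t := by positivity
  have hct' : ENNReal.ofReal ((c : ℝ) ^ t) = ((c ^ t : ℕ) : ENNReal) := by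
    rw [← Nat.cast_pow, ENNReal.ofReal_natCast]
  rw [ENNReal.ofReal_div_of_pos hct, ENNReal.le_div_iff_mul_le
    (Or.inl (ENNReal.ofReal_pos.mpr hct).ne') (Or.inl ENNReal.ofReal_ne_top), hct', mul_comm]
  refine le_trans ?_ hint
  refine le_trans (le_of_eq ?_) (mul_meas_ge_le_lintegral hmeas ((c ^ t : ℕ) : ENNReal))
  simp only [Nat.cast_le]

/-- Independence gives at most `(1 - q^(-d))^M ≤ exp(-M/q^d)`. -/
theorem measure_forall_notMem_closedBall_le {N : ℕ} {q : ℕ} (hq : 0 < q) {M : ℕ} (hM : M ≤ N)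
    (c : FlatTorus d n) :
    torusUniformPi d n N {p | ∀ i : Fin N, (i : ℕ) < M →
      p i ∉ Metric.closedBall c (torusSide d n / q)} ≤
      ENNReal.ofReal (Real.exp (-(M / (q : ℝ) ^ d))) := by
  set B := Metric.closedBall c (torusSide d n / q)
  have hB : torusUniform d n Bᶜ ≤ ENNReal.ofReal (Real.exp (-((q : ℝ) ^ d)⁻¹)) := by
    rw [← ENNReal.ofReal_toReal (measure_ne_top (torusUniform d n) Bᶜ)]
    refine ENNReal.ofReal_le_ofReal ?_
    rw [← measureReal_def, probReal_compl_eq_one_sub Metric.isClosed_closedBall.measurableSet]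
    have h1 := inv_pow_le_torusUniform_closedBall hq c
    have h2 := Real.add_one_le_exp (-((q : ℝ) ^ d)⁻¹)
    linarith
  have hset : {p : Fin N → FlatTorus d n | ∀ i : Fin N, (i : ℕ) < M → p i ∉ B} =
      Set.pi Set.univ fun i : Fin N => if (i : ℕ) < M then Bᶜ else Set.univ := by
    ext p
    simp only [Set.mem_ofPred_eq, Set.mem_pi, Set.mem_univ, true_implies]
    refine forall_congr' fun i => ?_
    split_ifs with h <;> simp [h]
  rw [hset, Measure.pi_pi]
  have hfac : ∀ i : Fin N, torusUniform d n (if (i : ℕ) < M then Bᶜ else Set.univ) =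
      if (i : ℕ) < M then torusUniform d n Bᶜ else 1 := by
    intro i
    split_ifs <;> simp
  rw [Finset.prod_congr rfl fun i _ => hfac i, Finset.prod_ite, Finset.prod_const,
    Finset.prod_const_one, mul_one]
  have hcard : (Finset.univ.filter fun i : Fin N => (i : ℕ) < M).card = M := by
    rw [Fin.card_filter_val_lt, min_eq_right hM]
  rw [hcard]
  calc _ ≤ ENNReal.ofReal (Real.exp (-((q : ℝ) ^ d)⁻¹)) ^ M := by gcongr
    _ = _ := by
      rw [← ENNReal.ofReal_pow (Real.exp_nonneg _), ← Real.exp_nat_mul]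
      congr 2
      ring

end Probability

/-! ### Path length for good positions -/

section Deterministic

variable {d n : ℕ} {p : Fin n → FlatTorus d n} {a : Fin n → Fin n}

theorem IsParentChoice.lt (h : IsParentChoice p a) (i : Fin n) (hi : 0 < (i : ℕ)) : a i < i :=
  ((h i).2 hi).1

theorem IsParentChoice.dist_lt (h : IsParentChoice p a) (hp : TieFree p) (i j : Fin n)
    (hj : j < i) (hja : j ≠ a i) : torusDist (p i) (p (a i)) < torusDist (p i) (p j) := by
  have hi : 0 < (i : ℕ) := lt_of_le_of_lt (Nat.zero_le _) hj
  exact lt_of_le_of_ne (((h i).2 hi).2 j hj) (hp i (a i) j (h.lt i hi).ne' hj.ne' hja.symm)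

theorem torusDist_hitLabel_le_sum (h : IsParentChoice p a) {m : ℕ} {e : Fin n → ℝ}
    (he0 : ∀ j, 0 ≤ e j)
    (he : ∀ j : Fin n, m < (j : ℕ) → torusDist (p j) (p (a j)) ≤ e j) (i : Fin n) :
    torusDist (p i) (p (hitLabel a m i)) ≤
      ∑ j ∈ Finset.filter (fun j : Fin n => m < (j : ℕ)) (insert i (properAncestors a i)), e j := by
  induction i using WellFoundedLT.induction with
  | ind i ih =>
    by_cases hi : (i : ℕ) ≤ m
    · rw [hitLabel_of_le hi, torusDist_self]
      exact Finset.sum_nonneg fun j _ => he0 j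
    · have hi := not_le.mp hi
      have hpos : 0 < (i : ℕ) := by omega
      rw [hitLabel_of_lt h.lt hi, Finset.filter_insert, if_pos hi, Finset.sum_insert fun hmem =>
        notMem_properAncestors a i (Finset.mem_filter.mp hmem).1,
        properAncestors_of_pos h.lt (fun i => (h i).1) hpos]
      exact (torusDist_triangle _ _ _).trans (add_le_add (he i hi) (ih _ (h.lt i hpos)))

theorem card_window_le (h : IsParentChoice p a) (hp : TieFree p) {c t M : ℕ} (hc : 1 < c)
    {l : Fin n} (hl : chainWeight torusDist (windowWeight c M) l (p l) (p ∘ revLabels l.isLt.le) <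
      c ^ t) :
    (Finset.filter (fun j : Fin n => M ≤ (j : ℕ) ∧ (j : ℕ) < 2 * M)
      (insert l (properAncestors a l))).card ≤ t := by
  rw [chainWeight_eq_prod torusDist _ p h.lt (fun i => (h i).1) (h.dist_lt hp)] at hl
  simp only [windowWeight] at hl
  rw [Finset.prod_ite, Finset.prod_const, Finset.prod_const_one, mul_one,
    Nat.pow_lt_pow_iff_right hc] at hl
  rw [Finset.filter_insert]
  split_ifs
  -- The weight counts proper ancestors only; the strict inequality leaves room for `l` itself.
  · exact (Finset.card_insert_le _ _).trans hl
  · exact hl.le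

theorem torusDist_hitLabel_le [NeZero n] (h : IsParentChoice p a) (hp : TieFree p) {m c t : ℕ}
    (hm : 0 < m) (hc : 1 < c) {q : ℕ → ℕ} (hq : ∀ k, 0 < q k)
    (hcover : ∀ k, 2 ^ k * m < n → ∀ j, ∃ i : Fin n, (i : ℕ) < 2 ^ k * m ∧
      p i ∈ Metric.closedBall (torusGrid d n (q k) j) (torusSide d n / q k))
    (hchain : ∀ k < n, ∀ l : Fin n, chainWeight torusDist (windowWeight c (2 ^ k * m)) l (p l)
      (p ∘ revLabels l.isLt.le) < c ^ t) (l : Fin n) :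
    torusDist (p l) (p (hitLabel a m l)) ≤
      ∑ k ∈ Finset.range n, t * (Real.sqrt d * (2 * (torusSide d n / q k))) := by
  set ρ : ℕ → ℝ := fun k => Real.sqrt d * (2 * (torusSide d n / q k)) with hρ
  have hL := (torusSide_pos d n).out
  have hρ0 : ∀ k, 0 ≤ ρ k := fun k => by positivity
  -- The index of the dyadic window containing `j`.
  set κ : Fin n → ℕ := fun j => Nat.log 2 (j / m) with hκ
  have hκ1 : ∀ j : Fin n, m < (j : ℕ) → 2 ^ κ j * m ≤ j ∧ (j : ℕ) < 2 * (2 ^ κ j * m) := by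
    intro j hj
    have h0 : (j : ℕ) / m ≠ 0 := (Nat.div_pos hj.le hm).ne'
    constructor
    · exact (Nat.le_div_iff_mul_le hm).mp (Nat.pow_log_le_self 2 h0)
    · have := (Nat.div_lt_iff_lt_mul hm).mp (Nat.lt_pow_succ_log_self one_lt_two ((j : ℕ) / m))
      rw [pow_succ] at this
      linarith
  have hedge : ∀ j : Fin n, m < (j : ℕ) → torusDist (p j) (p (a j)) ≤ ρ (κ j) := by
    intro j hj
    obtain ⟨h1, -⟩ := hκ1 j hj
    obtain ⟨g, hg⟩ := exists_dist_torusGrid_le (hq (κ j)) (p j)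
    -- An earlier label `i` shares the grid ball of `p j`, and the parent of `j` is at least as
    -- close as `i`.
    obtain ⟨i, hi, hig⟩ := hcover (κ j) (lt_of_le_of_lt h1 j.isLt) g
    refine (((h j).2 (by omega)).2 i (show (i : ℕ) < j by omega)).trans
      (torusDist_le_of_dist_le ?_)
    rw [two_mul]
    exact (dist_triangle_right _ _ _).trans (add_le_add hg (Metric.mem_closedBall.mp hig))
  refine (torusDist_hitLabel_le_sum h (fun j => hρ0 (κ j)) hedge l).trans ?_
  have hmaps : ∀ j ∈ Finset.filter (fun j : Fin n => m < (j : ℕ)) (insert l (properAncestors a l)),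
      κ j ∈ Finset.range n := by
    intro j _
    rw [Finset.mem_range]
    exact lt_of_le_of_lt ((Nat.log_le_self _ _).trans (Nat.div_le_self _ _)) j.isLt
  rw [← Finset.sum_fiberwise_of_maps_to hmaps]
  refine Finset.sum_le_sum fun k hk => ?_
  rw [Finset.sum_congr rfl fun j hj => by rw [(Finset.mem_filter.mp hj).2], Finset.sum_const,
    nsmul_eq_mul]
  refine mul_le_mul_of_nonneg_right (Nat.cast_le.mpr ?_) (hρ0 k)
  refine (Finset.card_le_card fun j hj => ?_).trans
    (card_window_le h hp hc (hchain k (Finset.mem_range.mp hk) l))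
  simp only [Finset.mem_filter] at hj ⊢
  obtain ⟨⟨hj1, hj2⟩, rfl⟩ := hj
  exact ⟨hj1, hκ1 j hj2⟩

end Deterministic

/-! ### Union bound for the bad positions -/

section UnionBound

variable {d n : ℕ} [NeZero n]

/-- The positions for which all long nearest neighbour chains are controlled: there are no ties,
the cells of the grid with `q k` points per axis contain a label below `2 ^ k * m`, and few labels
in `[2 ^ k * m, 2 ^ (k + 1) * m)` lie on a given chain. -/
def GoodPositions (m c t : ℕ) (q : ℕ → ℕ) (p : Fin n → FlatTorus d n) : Prop :=
  TieFree p ∧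
  (∀ k, 2 ^ k * m < n → ∀ j, ∃ i : Fin n, (i : ℕ) < 2 ^ k * m ∧
    p i ∈ Metric.closedBall (torusGrid d n (q k) j) (torusSide d n / q k)) ∧
  (∀ k < n, ∀ l : Fin n, chainWeight torusDist (windowWeight c (2 ^ k * m)) l (p l)
    (p ∘ revLabels l.isLt.le) < c ^ t)

theorem measure_not_goodPositions_le (hd : d ≠ 0) {m c t : ℕ} (hm : 0 < m) (hc : 0 < c)
    {q : ℕ → ℕ} (hq : ∀ k, 0 < q k) {s : ℝ} (hs : 1 ≤ s)
    (hqs : ∀ k, (q k : ℝ) ^ d * s ≤ (2 ^ k * m : ℕ)) :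
    torusUniformPi d n n {p | ¬ GoodPositions m c t q p} ≤
      ENNReal.ofReal (n * (n * Real.exp (-s)) + n * (n * (Real.exp c / c ^ t))) := by
  set μ := torusUniformPi d n n
  set B₁ : ℕ → Set (Fin n → FlatTorus d n) := fun k => {p | 2 ^ k * m < n ∧
    ∃ j, ∀ i : Fin n, (i : ℕ) < 2 ^ k * m →
      p i ∉ Metric.closedBall (torusGrid d n (q k) j) (torusSide d n / q k)} with hB₁
  set B₂ : ℕ → Fin n → Set (Fin n → FlatTorus d n) := fun k l => {p | c ^ t ≤
    chainWeight torusDist (windowWeight c (2 ^ k * m)) l (p l) (p ∘ revLabels l.isLt.le)} with hB₂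
  have hsub : {p | ¬ GoodPositions m c t q p} ⊆ {p | ¬ TieFree p} ∪
      ((⋃ k ∈ Finset.range n, B₁ k) ∪ ⋃ k ∈ Finset.range n, ⋃ l ∈ Finset.univ, B₂ k l) := by
    intro p hp
    by_contra hcon
    apply hp
    simp only [Set.mem_union, not_or, Set.mem_iUnion, not_exists, Finset.mem_range,
      Finset.mem_univ, hB₁, hB₂, Set.mem_ofPred_eq, not_not, not_and, not_le, not_forall] at hcon
    obtain ⟨h0, h1, h2⟩ := hcon
    refine ⟨h0, fun k hk j => ?_, fun k hk l => h2 k hk l trivial⟩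
    have hkn : k < n := by
      calc k < 2 ^ k := Nat.lt_two_pow_self
        _ ≤ 2 ^ k * m := Nat.le_mul_of_pos_right _ hm
        _ < n := hk
    obtain ⟨i, hi, hmem⟩ := h1 k hkn hk j
    exact ⟨i, hi, hmem⟩
  have hm1 : ∀ k, μ (B₁ k) ≤ ENNReal.ofReal (n * Real.exp (-s)) := by
    intro k
    by_cases hk : 2 ^ k * m < n
    · have hqd : (0 : ℝ) < (q k : ℝ) ^ d := pow_pos (Nat.cast_pos.mpr (hq k)) d
      -- At most `n` grid points enter the union bound.
      have hqn : (q k : ℝ) ^ d ≤ n := by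
        calc (q k : ℝ) ^ d ≤ (q k : ℝ) ^ d * s := le_mul_of_one_le_right hqd.le hs
          _ ≤ (2 ^ k * m : ℕ) := hqs k
          _ ≤ n := Nat.cast_le.mpr hk.le
      calc μ (B₁ k) ≤ μ (⋃ j ∈ (Finset.univ : Finset (Fin d → Fin (q k))),
            {p | ∀ i : Fin n, (i : ℕ) < 2 ^ k * m →
              p i ∉ Metric.closedBall (torusGrid d n (q k) j) (torusSide d n / q k)}) := by
            refine measure_mono fun p hp => ?_
            obtain ⟨-, j, hj⟩ := hp
            exact Set.mem_biUnion (Finset.mem_univ j) hj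
        _ ≤ ∑ j : Fin d → Fin (q k), μ {p | ∀ i : Fin n, (i : ℕ) < 2 ^ k * m →
              p i ∉ Metric.closedBall (torusGrid d n (q k) j) (torusSide d n / q k)} :=
            measure_biUnion_finset_le _ _
        _ ≤ ∑ _j : Fin d → Fin (q k), ENNReal.ofReal (Real.exp (-s)) := by
            refine Finset.sum_le_sum fun j _ =>
              (measure_forall_notMem_closedBall_le (hq k) hk.le _).trans
              (ENNReal.ofReal_le_ofReal (Real.exp_le_exp.mpr (neg_le_neg ?_)))
            rw [le_div_iff₀ hqd, mul_comm]
            exact hqs k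
        _ = ENNReal.ofReal ((q k : ℝ) ^ d * Real.exp (-s)) := by
            rw [Finset.sum_const, nsmul_eq_mul, ENNReal.ofReal_mul hqd.le]
            congr 1
            simp [ENNReal.ofReal_pow]
        _ ≤ _ := ENNReal.ofReal_le_ofReal (by gcongr)
    · simp [hB₁, hk]
  have hm2 : ∀ k l, μ (B₂ k l) ≤ ENNReal.ofReal (Real.exp c / c ^ t) := fun k l =>
    measure_pow_le_chainWeight_le hd hc t _ l
  have h0 : μ {p | ¬ TieFree p} = 0 := ae_tieFree hd n
  calc μ {p | ¬ GoodPositions m c t q p}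
      ≤ μ {p | ¬ TieFree p} + (μ (⋃ k ∈ Finset.range n, B₁ k) +
          μ (⋃ k ∈ Finset.range n, ⋃ l ∈ Finset.univ, B₂ k l)) :=
        (measure_mono hsub).trans ((measure_union_le _ _).trans
          (add_le_add le_rfl (measure_union_le _ _)))
    _ ≤ 0 + (∑ k ∈ Finset.range n, μ (B₁ k) +
          ∑ k ∈ Finset.range n, ∑ l : Fin n, μ (B₂ k l)) := by
        rw [h0]
        gcongr
        · exact measure_biUnion_finset_le _ _
        · exact (measure_biUnion_finset_le _ _).trans
            (Finset.sum_le_sum fun k _ => measure_biUnion_finset_le _ _)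
    _ ≤ 0 + (∑ _k ∈ Finset.range n, ENNReal.ofReal (n * Real.exp (-s)) +
          ∑ _k ∈ Finset.range n, ∑ _l : Fin n, ENNReal.ofReal (Real.exp c / c ^ t)) := by
        gcongr with k hk k hk l hl
        · exact hm1 k
        · exact hm2 k l
    _ = _ := by
        rw [zero_add, ENNReal.ofReal_add (by positivity) (by positivity),
          ENNReal.ofReal_mul (Nat.cast_nonneg n), ENNReal.ofReal_mul (p := (n : ℝ))
            (q := n * (Real.exp c / c ^ t)) (Nat.cast_nonneg n),
          ENNReal.ofReal_mul (p := (n : ℝ)) (q := Real.exp c / c ^ t) (Nat.cast_nonneg n)]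
        simp

theorem IsOnlineNNProcess.measure_not_goodPositions_le (hd : d ≠ 0) {Ω : Type*}
    [MeasurableSpace Ω] {P : Measure Ω} [IsProbabilityMeasure P] {V : Fin n → Ω → FlatTorus d n}
    {A : Ω → Fin n → Fin n} (hV : IsOnlineNNProcess P V A) {m c t : ℕ} (hm : 0 < m) (hc : 0 < c)
    {q : ℕ → ℕ} (hq : ∀ k, 0 < q k) {s : ℝ} (hs : 1 ≤ s)
    (hqs : ∀ k, (q k : ℝ) ^ d * s ≤ (2 ^ k * m : ℕ)) :
    P {ω | ¬ GoodPositions m c t q fun i => V i ω} ≤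
      ENNReal.ofReal (n * (n * Real.exp (-s)) + n * (n * (Real.exp c / c ^ t))) := by
  have hmeas : Measurable fun ω i => V i ω := measurable_pi_lambda _ hV.measurable_position
  have hmap : P.map (fun ω i => V i ω) = torusUniformPi d n n := by
    rw [(iIndepFun_iff_map_fun_eq_pi_map fun i => (hV.measurable_position i).aemeasurable).mp
      hV.independent_positions]
    exact congrArg Measure.pi (funext fun i => hV.uniform_position i)
  refine le_trans ?_ (_root_.measure_not_goodPositions_le hd hm hc hq hs hqs)
  rw [← hmap]
  -- This inequality holds for arbitrary sets, so the bad set need not be shown measurable.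
  exact Measure.le_map_apply hmeas.aemeasurable _

end UnionBound

/-! ### Choice of scales and numerical estimates -/

section Asymptotics

/-- The number of cells per axis of a grid on the torus of volume `n` such that every cell is
expected to hold at least `s` of the first `M` points. -/
noncomputable def gridSize (d M : ℕ) (s : ℝ) : ℕ := ⌊(M / s) ^ (1 / (d : ℝ))⌋₊

theorem one_le_gridSize {d M : ℕ} {s : ℝ} (hs : 0 < s) (hM : s ≤ M) : 1 ≤ gridSize d M s :=
  Nat.le_floor <| by
    rw [Nat.cast_one]
    exact Real.one_le_rpow ((one_le_div hs).mpr hM) (by positivity)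

theorem gridSize_pow_mul_le {d M : ℕ} {s : ℝ} (hd : d ≠ 0) (hs : 0 < s) :
    (gridSize d M s : ℝ) ^ d * s ≤ M := by
  have h0 : 0 ≤ M / s := by positivity
  rw [← le_div_iff₀ hs]
  calc (gridSize d M s : ℝ) ^ d ≤ ((M / s) ^ (1 / (d : ℝ))) ^ d := by
        gcongr
        exact Nat.floor_le (by positivity)
    _ = M / s := by rw [one_div, Real.rpow_inv_natCast_pow h0 hd]

theorem torusSide_div_gridSize_le {d n M : ℕ} {s : ℝ} (hs : 0 < s) (hM : s ≤ M) :
    torusSide d n / gridSize d M s ≤ 2 * (s * n / M) ^ (1 / (d : ℝ)) := by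
  have hM0 : (0 : ℝ) < M := hs.trans_le hM
  set x : ℝ := (M / s) ^ (1 / (d : ℝ)) with hx
  have hx0 : 0 < x := by positivity
  have hg : (1 : ℝ) ≤ gridSize d M s := Nat.one_le_cast.mpr (one_le_gridSize hs hM)
  -- As the floor is at least `1`, rounding down loses at most a factor `2`.
  have hxg : x ≤ 2 * gridSize d M s := by
    have : x < gridSize d M s + 1 := Nat.lt_floor_add_one x
    linarith
  have hsplit : (s * n / M) ^ (1 / (d : ℝ)) = torusSide d n / x := by
    rw [torusSide, hx, ← Real.div_rpow (Nat.cast_nonneg n) (by positivity)]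
    congr 1
    field_simp
  rw [hsplit, div_le_iff₀ (by linarith)]
  have hL : 0 ≤ torusSide d n := Real.rpow_nonneg (Nat.cast_nonneg n) _
  calc torusSide d n = torusSide d n / x * x := (div_mul_cancel₀ _ hx0.ne').symm
    _ ≤ torusSide d n / x * (2 * gridSize d M s) := by gcongr
    _ = _ := by ring

/-- The count `t ≤ (c/4) log m` cancels the factor `4/c` coming from `log n ≤ (log m)/c`. What
remains is `4 √d log m` times `(n log m / m)^(1/d)` times a geometric series, so the constant `6`
has slack. -/
theorem sum_gridSize_le {d n m t : ℕ} {c : ℝ} (hd : 1 ≤ d) (hc : 0 < c) (hc1 : c ≤ 1)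
    (hn : 1 ≤ 4 * Real.log n) (hnm : 4 * Real.log n ≤ m) (hlog : c * Real.log n ≤ Real.log m)
    (ht : (t : ℝ) ≤ c / 4 * Real.log m) :
    ∑ k ∈ Finset.range n, t * (Real.sqrt d *
      (2 * (torusSide d n / gridSize d (2 ^ k * m) (4 * Real.log n)))) ≤
      ancestorDistBound d n m := by
  set s : ℝ := 4 * Real.log n with hs
  set r : ℝ := (2 : ℝ) ^ (-(1 / (d : ℝ))) with hr
  have hs0 : 0 < s := by linarith
  have hm0 : (0 : ℝ) < m := hs0.trans_le hnm
  have hd0 : (0 : ℝ) < d := Nat.cast_pos.mpr hd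
  have hr0 : 0 < r := by positivity
  have hr1 : r < 1 := Real.rpow_lt_one_of_one_lt_of_neg one_lt_two (by simpa using hd0)
  have hlogn : 0 < Real.log n := by linarith
  have hlogm : 0 < Real.log m := lt_of_lt_of_le (by positivity) hlog
  set y : ℝ := (Real.log m * n / m) ^ (1 / (d : ℝ)) with hy
  have hy0 : 0 ≤ y := by positivity
  have hdinv : 1 / (d : ℝ) ≤ 1 := (div_le_one hd0).mpr (Nat.one_le_cast.mpr hd)
  have hscale : ∀ k : ℕ, torusSide d n / gridSize d (2 ^ k * m) s ≤ 2 * (4 / c * y * r ^ k) := by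
    intro k
    have hcast : ((2 ^ k * m : ℕ) : ℝ) = 2 ^ k * m := by push_cast; ring
    have hM : s ≤ (2 ^ k * m : ℕ) := by
      rw [hcast]
      exact hnm.trans (le_mul_of_one_le_left hm0.le (one_le_pow₀ one_le_two))
    refine (torusSide_div_gridSize_le hs0 hM).trans ?_
    gcongr
    rw [hcast]
    have h1 : s * n / (2 ^ k * m) ≤ 4 / c * (Real.log m * n / m) * (2 ^ k)⁻¹ := by
      have : s ≤ 4 / c * Real.log m := by
        rw [hs, div_mul_eq_mul_div, le_div_iff₀ hc]
        linarith
      calc s * n / (2 ^ k * m) ≤ 4 / c * Real.log m * n / (2 ^ k * m) := by gcongr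
        _ = _ := by field_simp
    have h2 : (((2 : ℝ) ^ k)⁻¹) ^ (1 / (d : ℝ)) = r ^ k := by
      rw [Real.inv_rpow (by positivity), ← Real.rpow_natCast, ← Real.rpow_mul (by norm_num),
        ← Real.rpow_neg (by norm_num), hr, ← Real.rpow_natCast, ← Real.rpow_mul (by norm_num)]
      congr 1
      ring
    calc (s * n / (2 ^ k * m)) ^ (1 / (d : ℝ))
        ≤ (4 / c * (Real.log m * n / m) * (2 ^ k)⁻¹) ^ (1 / (d : ℝ)) := by gcongr
      _ = (4 / c) ^ (1 / (d : ℝ)) * y * r ^ k := by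
        rw [Real.mul_rpow (by positivity) (by positivity), Real.mul_rpow (by positivity)
          (by positivity), h2]
      _ ≤ 4 / c * y * r ^ k := by
        have : (1 : ℝ) ≤ 4 / c := by
          rw [le_div_iff₀ hc]
          linarith
        gcongr
        calc (4 / c) ^ (1 / (d : ℝ)) ≤ (4 / c) ^ (1 : ℝ) := Real.rpow_le_rpow_of_exponent_le this hdinv
          _ = 4 / c := Real.rpow_one _
  have hgeom : ∑ k ∈ Finset.range n, r ^ k ≤ 1 / (1 - r) := by
    rw [one_div, ← tsum_geometric_of_lt_one hr0.le hr1]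
    exact (summable_geometric_of_lt_one hr0.le hr1).sum_le_tsum _ fun k _ => by positivity
  have hbound : ancestorDistBound d n m =
      6 * (Real.sqrt d * (1 / (1 - r)) * (Real.log m * y)) := by
    have hsplit : (Real.log m ^ (d + 1) * n / m) ^ (1 / (d : ℝ)) = Real.log m * y := by
      rw [pow_succ, mul_assoc, mul_div_assoc, Real.mul_rpow (by positivity) (by positivity), one_div,
        Real.pow_rpow_inv_natCast hlogm.le (by omega), ← one_div]
    rw [ancestorDistBound, hsplit]
    ring
  have h1r : 0 < 1 - r := by linarith
  calc _ ≤ ∑ k ∈ Finset.range n, c / 4 * Real.log m *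
        (Real.sqrt d * (2 * (2 * (4 / c * y * r ^ k)))) := by
        refine Finset.sum_le_sum fun k _ => ?_
        have hside : 0 ≤ torusSide d n := Real.rpow_nonneg (Nat.cast_nonneg n) _
        gcongr
        exact hscale k
    _ = 4 * (Real.sqrt d * (∑ k ∈ Finset.range n, r ^ k) * (Real.log m * y)) := by
        rw [Finset.mul_sum, Finset.sum_mul, Finset.mul_sum]
        refine Finset.sum_congr rfl fun k _ => ?_
        field_simp
        ring
    _ ≤ 6 * (Real.sqrt d * (1 / (1 - r)) * (Real.log m * y)) := by
        gcongr
        norm_num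
    _ = _ := hbound.symm

/-- The exponent `16/c²` is chosen so that `C^(t+1) ≥ n^4`. The spare factor `C`, due to rounding
`t` down, is absorbed with `e^C` into one factor `n`; each of the two terms is then at most `1/n`.
-/
theorem failure_probability_le {n m C t : ℕ} {c : ℝ} (hc : 0 < c)
    (hn : 0 < n) (hlog : c * Real.log n ≤ Real.log m) (hC : Real.exp (16 / c ^ 2) ≤ C)
    (hCn : Real.exp C * C ≤ n) (ht : c / 4 * Real.log m ≤ t + 1) :
    n * (n * Real.exp (-(4 * Real.log n))) + n * (n * (Real.exp C / C ^ t)) ≤ 2 / (n : ℝ) := by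
  have hn0 : (1 : ℝ) ≤ n := Nat.one_le_cast.mpr hn
  have hlogn : 0 ≤ Real.log n := Real.log_nonneg hn0
  have hC0 : (0 : ℝ) < C := (Real.exp_pos _).trans_le hC
  have hexp : Real.exp (4 * Real.log n) = (n : ℝ) ^ 4 := by
    rw [mul_comm, Real.exp_mul, Real.exp_log (by linarith)]
    norm_cast
  have hpow : (n : ℝ) ^ 4 ≤ C ^ (t + 1) := by
    calc (n : ℝ) ^ 4 = Real.exp (4 * Real.log n) := hexp.symm
      _ ≤ Real.exp ((t + 1 : ℕ) * (16 / c ^ 2)) := by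
        refine Real.exp_le_exp.mpr ?_
        calc 4 * Real.log n = c / 4 * (c * Real.log n) * (16 / c ^ 2) := by
              field_simp
              ring
          _ ≤ (t + 1 : ℕ) * (16 / c ^ 2) := by
            gcongr
            push_cast
            refine le_trans ?_ ht
            gcongr
      _ = Real.exp (16 / c ^ 2) ^ (t + 1) := Real.exp_nat_mul _ _
      _ ≤ C ^ (t + 1) := by gcongr
  have h2 : Real.exp C / C ^ t ≤ 1 / (n : ℝ) ^ 3 := by
    rw [div_le_div_iff₀ (by positivity) (by positivity), one_mul]
    refine le_of_mul_le_mul_right ?_ (mul_pos hC0 (show (0 : ℝ) < n by linarith))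
    calc Real.exp C * (n : ℝ) ^ 3 * ((C : ℝ) * n) = (Real.exp C * C) * (n : ℝ) ^ 4 := by ring
      _ ≤ n * (C : ℝ) ^ (t + 1) := by gcongr
      _ = (C : ℝ) ^ t * ((C : ℝ) * n) := by ring
  have h1 : Real.exp (-(4 * Real.log n)) ≤ 1 / (n : ℝ) ^ 3 := by
    rw [Real.exp_neg, hexp, one_div]
    exact inv_anti₀ (by positivity) (pow_le_pow_right₀ hn0 (by norm_num))
  calc _ ≤ n * (n * (1 / (n : ℝ) ^ 3)) + n * (n * (1 / (n : ℝ) ^ 3)) := by gcongr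
    _ = 2 / (n : ℝ) := by
      have : (n : ℝ) ≠ 0 := by linarith
      field_simp
      ring

end Asymptotics

/-! ### Assembly of the main theorem -/

theorem mainTheorem8 (d : ℕ) (hd : 1 ≤ d) (m : ℕ → ℕ)
    (hm : ∃ c : ℝ, 0 < c ∧ ∀ᶠ n : ℕ in atTop, (n : ℝ) ^ c ≤ (m n : ℝ)) :
    ∀ᶠ n : ℕ in atTop, ∀ [NeZero n] {Ω : Type*} [MeasurableSpace Ω] (P : Measure Ω)
      [IsProbabilityMeasure P] (V : Fin n → Ω → FlatTorus d n) (A : Ω → Fin n → Fin n),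
      IsOnlineNNProcess P V A →
        (∀ (ω : Ω) (l : Fin n), m n < (l : ℕ) →
          (∃! k : Fin n, IsGraphNearest (parentGraph (A ω)) (labelsUpTo n (m n)) l k) ∧
          ∀ k : Fin n, IsGraphNearest (parentGraph (A ω)) (labelsUpTo n (m n)) l k →
            ∃ t : ℕ, (A ω)^[t] l = k) ∧
        1 - 3 / (m n : ℝ) ≤
          P.real {ω | ∀ l k : Fin n, m n < (l : ℕ) →
            IsGraphNearest (parentGraph (A ω)) (labelsUpTo n (m n)) l k →
              torusDist (V l ω) (V k ω) ≤ ancestorDistBound d n (m n)} := by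
  obtain ⟨c₀, hc₀, hm⟩ := hm
  set c : ℝ := min c₀ 1 with hcdef
  have hc : 0 < c := lt_min hc₀ one_pos
  have hc1 : c ≤ 1 := min_le_right _ _
  obtain ⟨C, hC⟩ := exists_nat_ge (Real.exp (16 / c ^ 2))
  have hC1 : 1 < C := by
    have : (1 : ℝ) < C := (Real.one_lt_exp_iff.mpr (by positivity)).trans_le hC
    exact_mod_cast this
  have hlogpow : ∀ᶠ n : ℕ in atTop, 4 * Real.log n ≤ (n : ℝ) ^ c := by
    have h := ((isLittleO_log_rpow_atTop hc).comp_tendsto tendsto_natCast_atTop_atTop).bound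
      (show (0 : ℝ) < 1 / 4 by norm_num)
    filter_upwards [h] with n hn
    simp only [Function.comp_apply, Real.norm_eq_abs] at hn
    rw [abs_of_nonneg (Real.rpow_nonneg (Nat.cast_nonneg n) c)] at hn
    linarith [le_abs_self (Real.log n)]
  have hlarge : ∀ᶠ n : ℕ in atTop, Real.exp C * C ≤ n :=
    tendsto_natCast_atTop_atTop.eventually_ge_atTop _
  filter_upwards [hm, hlogpow, hlarge, eventually_ge_atTop 3] with n hmn hlogn hCn hn3
  intro _ Ω _ P _ V A hV
  have hlt : ∀ ω (i : Fin n), 0 < (i : ℕ) → A ω i < i := fun ω => (hV.isParentChoice ω).lt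
  refine ⟨fun ω l _ => ?_, ?_⟩
  · simp only [isGraphNearest_iff (hlt ω)]
    exact ⟨⟨_, rfl, fun k hk => hk⟩, fun k hk => ⟨hitTime (A ω) (m n) l, hk.symm⟩⟩
  simp only [fun ω => isGraphNearest_iff (hlt ω)]
  rcases le_or_gt n (m n) with hnm | hmn'
  -- No label exceeds `m n` here, so the event is the whole space.
  · have huniv : {ω | ∀ l k : Fin n, m n < (l : ℕ) → k = hitLabel (A ω) (m n) l →
        torusDist (V l ω) (V k ω) ≤ ancestorDistBound d n (m n)} = Set.univ := by
      refine Set.eq_univ_of_forall fun ω l k hl => ?_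
      have := l.isLt
      omega
    rw [huniv, probReal_univ]
    have : (0 : ℝ) ≤ 3 / (m n : ℝ) := by positivity
    linarith
  have hn1 : (1 : ℝ) ≤ n := by exact_mod_cast (by omega : 1 ≤ n)
  have hlogn1 : 1 ≤ Real.log n := by
    rw [Real.le_log_iff_exp_le (by linarith)]
    have h3 : (3 : ℝ) ≤ n := by exact_mod_cast hn3
    linarith [Real.exp_one_lt_d9]
  have hmc : (n : ℝ) ^ c ≤ m n :=
    (Real.rpow_le_rpow_of_exponent_le hn1 (min_le_left _ _)).trans hmn
  have hs : 1 ≤ 4 * Real.log n := by linarith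
  have hsm : 4 * Real.log n ≤ m n := hlogn.trans hmc
  have hm0 : (0 : ℝ) < m n := by linarith
  have hm0' : 0 < m n := by exact_mod_cast hm0
  have hlog : c * Real.log n ≤ Real.log (m n) := by
    rw [← Real.log_rpow (by linarith)]
    exact Real.log_le_log (by positivity) hmc
  have hlogm : 0 ≤ c / 4 * Real.log (m n) := by
    have : 0 ≤ Real.log (m n) := le_trans (by positivity) hlog
    positivity
  set t := ⌊c / 4 * Real.log (m n)⌋₊ with ht
  set q : ℕ → ℕ := fun k => gridSize d (2 ^ k * m n) (4 * Real.log n) with hq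
  have hq1 : ∀ k, 0 < q k := by
    intro k
    refine one_le_gridSize (by linarith) (hsm.trans ?_)
    exact_mod_cast Nat.le_mul_of_pos_left _ (by positivity)
  have hbad := hV.measure_not_goodPositions_le (by omega : d ≠ 0) (t := t) hm0' (by omega : 0 < C)
    hq1 hs fun k => gridSize_pow_mul_le (by omega) (by linarith)
  set S : Set Ω := {ω | ∀ l k : Fin n, m n < (l : ℕ) → k = hitLabel (A ω) (m n) l →
    torusDist (V l ω) (V k ω) ≤ ancestorDistBound d n (m n)} with hS
  have hsub : Sᶜ ⊆ {ω | ¬ GoodPositions (m n) C t q fun i => V i ω} := by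
    intro ω hω hgood
    refine hω fun l k _ hk => ?_
    rw [hk]
    exact (torusDist_hitLabel_le (hV.isParentChoice ω) hgood.1 hm0' hC1 hq1 hgood.2.1 hgood.2.2
      l).trans (sum_gridSize_le hd hc hc1 hs hsm hlog (Nat.floor_le hlogm))
  have hfail := failure_probability_le hc (by omega : 0 < n) hlog hC hCn
    (Nat.lt_floor_add_one (c / 4 * Real.log (m n))).le
  have hcompl : P.real Sᶜ ≤ 3 / (m n : ℝ) := by
    have h1 : P.real Sᶜ ≤ 2 / (n : ℝ) := by
      refine ENNReal.toReal_le_of_le_ofReal (by positivity) ?_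
      exact (measure_mono hsub).trans (hbad.trans (ENNReal.ofReal_le_ofReal hfail))
    refine h1.trans ?_
    have : (m n : ℝ) ≤ n := Nat.cast_le.mpr hmn'.le
    gcongr
    norm_num
  -- Subadditivity suffices and avoids measurability of `S`.
  have huniv : 1 ≤ P.real S + P.real Sᶜ := by
    rw [← probReal_univ (μ := P), ← Set.union_compl_self S]
    exact measureReal_union_le _ _
  linarith
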